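/- Define integers $T^3(n,k)$, $0\le k\le n$, by $T^3(0,0)=1$, $T^3(n,n)=0$ for $n>0$, and $$T^3(n,k)=\sum_{j=0}^{k}(k-j+1)\,T^3(n-1,j)\qquad(n>0,\ 0\le k<n).$$ In the standard arc diagram of a set partition $P$ of $[n]$, one places $n$ points on the boundary line of a closed half-plane, in the order $1,\dots,n$, and joins $i<j$ by an arc (a semicircle in the half-plane) exactly when $i$ and $j$ are consecutive elements of a block of $P$. The partition is planar (noncrossing) if no two arcs cross. A double planar partition of $[n]$ is a pair $(P_1,P_2)$ of planar partitions of $[n]$ such that every block of $P_1$ is contained in a block of $P_2$. Its diagram of arcs and ties consists of the $n$ points, the arcs of $P_1$, and ties (drawn as further semicircles) connecting the blocks of $P_1$ that lie in the same block of $P_2$: whenever $j$ is the least element of its $P_1$-block but not the least element of its $P_2$-block, a tie joins $j$ to the element immediately preceding $j$ in its $P_2$-block. Let $U$ be the unbounded region of the complement of the diagram in the half-plane. The boxes of the diagram are the connected components of the complement of $U$ in the half-plane, that is, of the union of the points, the arcs, the ties and the bounded regions. Then for all $n\ge 0$ and $0\le k\le n$, the number of double planar partitions of $[n]$ whose diagrams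 have exactly $n-k$ boxes is $T^3(n,k)$. Moreover, the total number of double planar partitions of $[n]$ is the Fuss–Catalan number $$A^3_n=\frac{1}{3n+1}\binom{3n+1}{n}.$$ -/

import Mathlib

/-- The triangle `T^p(n,k)` (`p > 0`), extended by `0` to `k > n`:
`T^p(0,0) = 1`, `T^p(n,n) = 0` for `n > 0`, and
`T^p(n,k) = ∑_{j=0}^{k} binom(k-j+p-2, p-2) T^p(n-1,j)` for `0 ≤ k < n`.
The binomial coefficient is written in the symmetric form `binom(k-j+p-2, k-j)`,
which for `p = 1` is `1` if `j = k` and `0` otherwise. -/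
def fussCatalanTriangle (p : ℕ) : ℕ → ℕ → ℕ
  | 0, k => if k = 0 then 1 else 0
  | n + 1, k =>
      if k < n + 1 then
        ∑ j ∈ Finset.range (k + 1),
          (k - j + p - 2).choose (k - j) * fussCatalanTriangle p n j
      else 0

/-- The Fuss-Catalan number `A^p_n = binom(pn+1, n) / (pn+1)`. -/
def fussCatalan (p n : ℕ) : ℚ :=
  ((p * n + 1).choose n : ℚ) / ((p : ℚ) * n + 1)

/- Set partitions of an `n`-element linearly ordered set are equivalence relations on `Fin n`;
the blocks are the equivalence classes, and `P ≤ Q` says that `P` refines `Q`. -/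

/-- `i` and `j` are joined by an arc in the standard arc diagram of `P`: they are consecutive
elements of a block. -/
def IsArc {n : ℕ} (P : Setoid (Fin n)) (i j : Fin n) : Prop :=
  i < j ∧ P i j ∧ ∀ k, i < k → k < j → ¬ P i k

/-- `P` is planar: no two arcs of its standard diagram cross. -/
def IsPlanar {n : ℕ} (P : Setoid (Fin n)) : Prop :=
  ∀ a b c d : Fin n, IsArc P a b → IsArc P c d → ¬ (a < c ∧ c < b ∧ b < d)

/-- A double planar partition: two planar partitions, the first one refining the second one. -/
structure DoublePlanarPartition (n : ℕ) where
  fst : Setoid (Fin n)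
  snd : Setoid (Fin n)
  fst_planar : IsPlanar fst
  snd_planar : IsPlanar snd
  refines : fst ≤ snd

/-- The ties of the standard diagram of arcs and ties of `(P, Q)`. If `j` is the least element of
its `P`-block, but not of its `Q`-block, then a tie joins `j` to the element `i` that precedes it
in its `Q`-block (`i` and `j` lie in different `P`-blocks). Two `P`-blocks lie in the same
`Q`-block if and only if a chain of ties links them, and no tie is redundant. -/
def IsTie {n : ℕ} (P Q : Setoid (Fin n)) (i j : Fin n) : Prop :=
  IsArc Q i j ∧ ∀ k, P k j → j ≤ k

/-- The closed half-plane in which diagrams are drawn. -/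
def halfPlane : Set ℂ := {z | 0 ≤ z.im}

/-- The semicircle in the half-plane with end points `a < b` on the boundary line. -/
def semicircle (a b : ℝ) : Set ℂ :=
  {z | z ∈ halfPlane ∧ dist z (((a + b) / 2 : ℝ) : ℂ) = (b - a) / 2}

/-- Given a set `D` drawn in the half-plane: the union `U` of the unbounded regions, i.e. of the
unbounded connected components of the complement of `D` in the half-plane. -/
def outerRegion (D : Set ℂ) : Set ℂ :=
  {z | z ∈ halfPlane \ D ∧ ¬ Bornology.IsBounded (connectedComponentIn (halfPlane \ D) z)}

/-- The boxes of a drawing `D`: the connected components of the complement of `U` in the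
half-plane, this complement being the union of the points, the arcs, the ties and the bounded
regions. -/
def boxes (D : Set ℂ) : Set (Set ℂ) :=
  (fun z => connectedComponentIn (halfPlane \ outerRegion D) z) '' (halfPlane \ outerRegion D)

/-- The diagram of arcs and ties of a double planar partition, drawn in the half-plane: the `n`
points on the boundary line, a semicircle for every arc and a semicircle for every tie. -/
def DoublePlanarPartition.diagram {n : ℕ} (R : DoublePlanarPartition n) : Set ℂ :=
  {z | ∃ i : Fin n, z = ((i : ℕ) : ℂ)} ∪
    {z | ∃ i j : Fin n, (IsArc R.fst i j ∨ IsTie R.fst R.snd i j) ∧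
      z ∈ semicircle ((i : ℕ) : ℝ) ((j : ℕ) : ℝ)}

/-! A box is a maximal run of points with every gap bridged by an arc or tie, and the bridged gaps
are those bridged by a block of `P₂`. So boxes correspond to the points `k` before which `P₂` can be
cut (`starts`, `ncard_boxes`). Topologically, removing the outer region leaves the marked points and
full half discs, and vertical lines through unbridged gaps separate the components.

Delete the last of `n + 1` points, with `s ≤ p` the least elements of its `P₂`- and `P₁`-blocks. By
planarity, cutting at `s` and `p` damages no other block, and the process reverses: any two cuts `s
≤ p` of the smaller partition, the trivial cut at the last point included, are allowed
(`succEquiv`). The cuts of the larger partition are the cuts up to `s`. From `c` boxes, `m` boxes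
arise in `c + 2 - m` ways: `s` is the `m`-th of `c + 1` cuts and `p` is any cut from `s` on. With `c
= n - j` and `m = n + 1 - k` this weight is `k - j + 1`, the recurrence of the triangle.

The entries and their partial sums are Raney numbers, which gives the total. -/

/-! ### The triangle in terms of Raney numbers. -/

/-- The Raney number `a / (3k + a) * binom(3k + a, k)`, with value `1` at `k = 0`. -/
def raney (a : ℕ) : ℕ → ℚ
  | 0 => 1
  | k + 1 => (a : ℚ) / (k + 1) * ((3 * k + a + 2).choose k : ℚ)

/-- With `B = 1 + x B^3`, `raney a` lists the coefficients of `B^a`, and this is `B^(a+1) = B^a + x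
B^(a+3)`. -/
theorem raney_succ_succ (a k : ℕ) : raney (a + 1) (k + 1) = raney a (k + 1) + raney (a + 3) k := by
  cases k with
  | zero => simp [raney]
  | succ k =>
    have h1 : ((3 * (k + 1) + a + 3).choose (k + 1) : ℚ) =
        (3 * (k + 1) + a + 2).choose k + (3 * (k + 1) + a + 2).choose (k + 1) := by
      exact_mod_cast Nat.choose_succ_succ (3 * (k + 1) + a + 2) k
    have h2 : ((3 * (k + 1) + a + 2).choose (k + 1) : ℚ) * (k + 1) =
        (3 * (k + 1) + a + 2).choose k * (2 * k + a + 5) := by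
      have := Nat.choose_succ_right_eq (3 * (k + 1) + a + 2) k
      rw [show 3 * (k + 1) + a + 2 - k = 2 * k + a + 5 by omega] at this
      exact_mod_cast this
    simp only [raney]
    rw [show 3 * (k + 1) + (a + 1) + 2 = 3 * (k + 1) + a + 3 by ring, h1,
      show 3 * k + (a + 3) + 2 = 3 * (k + 1) + a + 2 by ring]
    generalize ((3 * (k + 1) + a + 2).choose (k + 1) : ℚ) = x at *
    generalize ((3 * (k + 1) + a + 2).choose k : ℚ) = y at *
    push_cast
    field_simp
    linear_combination h2

theorem raney_zero_succ (k : ℕ) : raney 0 (k + 1) = 0 := by simp [raney]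

theorem raney_one (n : ℕ) : raney 1 n = fussCatalan 3 n := by
  cases n with
  | zero => simp [raney, fussCatalan]
  | succ k =>
    have h2 : ((3 * k + 4).choose (k + 1) : ℚ) * (k + 1) =
        (3 * k + 3).choose k * (3 * k + 4) := by
      have := Nat.add_one_mul_choose_eq (3 * k + 3) k
      push_cast [← @Nat.cast_inj ℚ] at this
      linear_combination -this
    simp only [raney, fussCatalan]
    rw [show 3 * k + 1 + 2 = 3 * k + 3 by ring, show 3 * (k + 1) + 1 = 3 * k + 4 by ring]
    push_cast
    field_simp
    linear_combination -h2

theorem fussCatalanTriangle_three_succ {n k : ℕ} (h : k ≤ n) :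
    fussCatalanTriangle 3 (n + 1) k =
      ∑ j ∈ Finset.range (k + 1), (k - j + 1) * fussCatalanTriangle 3 n j := by
  rw [fussCatalanTriangle, if_pos (by omega)]
  refine Finset.sum_congr rfl fun j _ => ?_
  rw [show k - j + 3 - 2 = k - j + 1 by omega, Nat.choose_succ_self_right]

/-- Raising `k` by one raises every weight `k - j + 1` by one, so the difference is a partial sum of
the previous row. -/
theorem fussCatalanTriangle_three_succ_succ {n k : ℕ} (h : k + 1 ≤ n) :
    fussCatalanTriangle 3 (n + 1) (k + 1) = fussCatalanTriangle 3 (n + 1) k +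
      ∑ j ∈ Finset.range (k + 2), fussCatalanTriangle 3 n j := by
  rw [fussCatalanTriangle_three_succ h, fussCatalanTriangle_three_succ (by omega),
    Finset.sum_range_succ, Finset.sum_range_succ _ (k + 1), ← add_assoc, ← Finset.sum_add_distrib]
  congr 1
  · refine Finset.sum_congr rfl fun j hj => ?_
    have := Finset.mem_range.1 hj
    rw [show k + 1 - j = k - j + 1 by omega]
    ring
  · simp

/-- The partial sums telescope by `raney_succ_succ` with `a = 2 * (n - (k + 1))`, since `a + 3 = 2 *
(n - k) + 1`. -/
theorem sum_fussCatalanTriangle_three_of_eq_raney {n : ℕ}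
    (h : ∀ k ≤ n, (fussCatalanTriangle 3 n k : ℚ) = raney (2 * (n - k)) k) {k : ℕ} (hk : k ≤ n) :
    ∑ j ∈ Finset.range (k + 1), (fussCatalanTriangle 3 n j : ℚ) = raney (2 * (n - k) + 1) k := by
  induction k with
  | zero => simp [h 0 hk, raney]
  | succ k ih =>
    rw [Finset.sum_range_succ, ih (by omega), h _ hk, raney_succ_succ, add_comm]
    congr 2
    omega

theorem fussCatalanTriangle_three_eq_raney (n : ℕ) :
    ∀ k ≤ n, (fussCatalanTriangle 3 n k : ℚ) = raney (2 * (n - k)) k := by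
  induction n with
  | zero => intro k hk; obtain rfl : k = 0 := by omega
            simp [fussCatalanTriangle, raney]
  | succ n ih =>
    intro k hk
    induction k with
    | zero =>
      rw [fussCatalanTriangle_three_succ (by omega)]
      simp [ih 0 (by omega), raney]
    | succ k ihk =>
      rcases Nat.lt_or_ge n (k + 1) with h | h
      -- On the diagonal both sides vanish, the Raney parameter being `0`.
      · obtain rfl : k = n := by omega
        simp [fussCatalanTriangle, raney_zero_succ]
      · rw [fussCatalanTriangle_three_succ_succ h]
        push_cast
        have hR : raney (2 * (n - k)) (k + 1) =
            raney (2 * (n - (k + 1)) + 1) (k + 1) + raney (2 * (n + 1 - k)) k := by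
          rw [show 2 * (n - k) = 2 * (n - (k + 1)) + 1 + 1 by omega, raney_succ_succ]
          congr 2
          omega
        rw [hR, ihk (by omega), sum_fussCatalanTriangle_three_of_eq_raney ih h, add_comm]

theorem sum_fussCatalanTriangle_three (n : ℕ) :
    ∑ k ∈ Finset.range (n + 1), (fussCatalanTriangle 3 n k : ℚ) = fussCatalan 3 n := by
  rw [sum_fussCatalanTriangle_three_of_eq_raney (fussCatalanTriangle_three_eq_raney n) le_rfl]
  simp [raney_one]

/-! ### Arcs, blocks and bridged gaps. -/

section Arcs

variable {n : ℕ} {P Q : Setoid (Fin n)}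

/-- The arc joins the last element of the block before `k` to the first one from `k` on. -/
theorem exists_isArc_of_lt_of_le {x y k : Fin n} (h : P x y) (hx : x < k) (hy : k ≤ y) :
    ∃ a b, IsArc P a b ∧ P x a ∧ x ≤ a ∧ a < k ∧ k ≤ b ∧ b ≤ y := by
  obtain ⟨a, ⟨ha, hak⟩, hmax⟩ := Set.exists_max_image {i | P x i ∧ i < k} id (Set.toFinite _)
    ⟨x, P.refl' x, hx⟩
  obtain ⟨b, ⟨hb, hbk⟩, hmin⟩ := Set.exists_min_image {i | P x i ∧ k ≤ i} id (Set.toFinite _)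
    ⟨y, h, hy⟩
  refine ⟨a, b, ⟨hak.trans_le hbk, P.trans' (P.symm' ha) hb, fun i hai hib hi => ?_⟩, ha,
    hmax x ⟨P.refl' x, hx⟩, hak, hbk, hmin y ⟨h, hy⟩⟩
  rcases lt_or_ge i k with hik | hik
  · exact (hmax i ⟨P.trans' ha hi, hik⟩).not_gt hai
  · exact (hmin i ⟨P.trans' ha hi, hik⟩).not_gt hib

/-- A partition is planar if and only if no two blocks cross. -/
theorem isPlanar_iff : IsPlanar P ↔
    ∀ a b c d : Fin n, a < b → b < c → c < d → P a c → P b d → P a b := by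
  constructor
  · intro h a b c d hab hbc hcd hac hbd
    by_contra hn
    obtain ⟨a', c', h1, h2, h3, h4, h5, h6⟩ := exists_isArc_of_lt_of_le hac hab hbc.le
    have hac' : P a c' := P.trans' h2 h1.2.1
    have hbc' : b < c' := h5.lt_of_ne (by rintro rfl; exact hn hac')
    obtain ⟨b', d', k1, k2, k3, k4, k5, k6⟩ :=
      exists_isArc_of_lt_of_le hbd hbc' (h6.trans hcd.le)
    have hbd' : P b d' := P.trans' k2 k1.2.1
    refine h a' c' b' d' h1 k1 ⟨h4.trans_le k3, k4, k5.lt_of_ne ?_⟩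
    rintro rfl
    exact hn (P.trans' hac' (P.symm' hbd'))
  · rintro h a b c d hab hcd ⟨hac, hcb, hbd⟩
    exact hab.2.2 c hac hcb (h a c b d hac hcb hbd hab.2.1 hcd.2.1)

theorem exists_isArc_or_isTie_iff (hPQ : P ≤ Q) (k : Fin n) :
    (∃ i j, (IsArc P i j ∨ IsTie P Q i j) ∧ i < k ∧ k ≤ j) ↔ ∃ x y, Q x y ∧ x < k ∧ k ≤ y := by
  constructor
  · rintro ⟨i, j, h | h, hk⟩
    · exact ⟨i, j, hPQ h.2.1, hk⟩
    · exact ⟨i, j, h.1.2.1, hk⟩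
  · rintro ⟨x, y, h, hx, hy⟩
    obtain ⟨a, b, hab, -, -, hak, hkb, -⟩ := exists_isArc_of_lt_of_le h hx hy
    by_cases hb : ∀ i, P i b → b ≤ i
    · exact ⟨a, b, .inr ⟨hab, hb⟩, hak, hkb⟩
    · push Not at hb
      obtain ⟨i, hi, hib⟩ := hb
      obtain ⟨c, d, hcd, hic, -, hcb, hbd, hdb⟩ := exists_isArc_of_lt_of_le hi hib le_rfl
      obtain rfl : d = b := le_antisymm hdb hbd
      refine ⟨c, d, .inl hcd, lt_of_le_of_lt ?_ hak, hkb⟩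
      by_contra! hac
      exact hab.2.2 c hac hcb (Q.trans' hab.2.1 (Q.symm' (hPQ hcd.2.1)))

end Arcs

/-! ### Cuts, and removal of the last point. -/

open Classical in
/-- The least element of the block of `x`. -/
noncomputable def blockMin {n : ℕ} (P : Setoid (Fin n)) (x : Fin n) : Fin n :=
  (Finset.univ.filter (P x)).min' ⟨x, by simp⟩

theorem rel_blockMin {n : ℕ} (P : Setoid (Fin n)) (x : Fin n) : P x (blockMin P x) := by
  classical
  exact (Finset.mem_filter.1 ((Finset.univ.filter (P x)).min'_mem ⟨x, by simp⟩)).2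

theorem blockMin_le {n : ℕ} {P : Setoid (Fin n)} {x y : Fin n} (h : P x y) :
    blockMin P x ≤ y := by
  classical
  exact Finset.min'_le _ _ (by simp [h])

theorem blockMin_eq {n : ℕ} {P : Setoid (Fin n)} {x y : Fin n} (h : P x y)
    (hy : ∀ z, P x z → y ≤ z) : blockMin P x = y :=
  le_antisymm (blockMin_le h) (hy _ (rel_blockMin P x))

/-- `k` separates the partition `P`: no block has elements on both sides of the gap before `k`. -/
def IsCut {n : ℕ} (P : Setoid (Fin n)) (k : Fin n) : Prop :=
  ∀ x y, P x y → x < k → y < k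

theorem IsCut.lt_iff {n : ℕ} {P : Setoid (Fin n)} {k : Fin n} (h : IsCut P k) {x y : Fin n}
    (hxy : P x y) : x < k ↔ y < k :=
  ⟨h x y hxy, h y x (P.symm' hxy)⟩

/-- A block straddling the gap before this minimum would cross the block of the last point. -/
theorem isCut_blockMin_last {n : ℕ} {P : Setoid (Fin (n + 1))} (hP : IsPlanar P) :
    IsCut P (blockMin P (Fin.last n)) := by
  intro x y hxy hx
  by_contra! hy
  have hs := rel_blockMin P (Fin.last n)
  refine hx.not_ge (blockMin_le ?_)
  rcases hy.eq_or_lt with rfl | hy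
  · exact P.trans' hs (P.symm' hxy)
  rcases (Fin.le_last y).eq_or_lt with rfl | hl
  · exact P.symm' hxy
  · exact P.trans' hs (P.symm' (isPlanar_iff.1 hP x _ y _ hx hy hl hxy (P.symm' hs)))

namespace Setoid

/-- Extend a partition of `n` points by a last point that is a block of its own. -/
def addLast {n : ℕ} (P : Setoid (Fin n)) : Setoid (Fin (n + 1)) where
  r x y := x = y ∨ ∃ i j, P i j ∧ i.castSucc = x ∧ j.castSucc = y
  iseqv :=
    { refl := fun _ => .inl rfl
      symm := by
        rintro x y (rfl | ⟨i, j, h, rfl, rfl⟩)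
        · exact .inl rfl
        · exact .inr ⟨j, i, P.symm' h, rfl, rfl⟩
      trans := by
        rintro x y z (rfl | ⟨i, j, h, rfl, rfl⟩) (rfl | ⟨k, l, h', hk, rfl⟩)
        · exact .inl rfl
        · exact .inr ⟨k, l, h', hk, rfl⟩
        · exact .inr ⟨i, j, h, rfl, rfl⟩
        · obtain rfl := Fin.castSucc_injective _ hk
          exact .inr ⟨i, l, P.trans' h h', rfl, rfl⟩ }

theorem addLast_castSucc {n : ℕ} {P : Setoid (Fin n)} {i j : Fin n} :
    P.addLast i.castSucc j.castSucc ↔ P i j := by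
  constructor
  · rintro (h | ⟨k, l, h, hk, hl⟩)
    · obtain rfl := Fin.castSucc_injective _ h
      exact P.refl' i
    · obtain rfl := Fin.castSucc_injective _ hk
      obtain rfl := Fin.castSucc_injective _ hl
      exact h
  · exact fun h => .inr ⟨i, j, h, rfl, rfl⟩

theorem eq_last_of_addLast {n : ℕ} {P : Setoid (Fin n)} {x : Fin (n + 1)}
    (h : P.addLast x (Fin.last n)) : x = Fin.last n := by
  rcases h with h | ⟨i, j, -, -, h⟩
  · exact h
  · exact absurd h (Fin.castSucc_ne_last j)

theorem addLast_mono {n : ℕ} {P Q : Setoid (Fin n)} (h : P ≤ Q) : P.addLast ≤ Q.addLast := by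
  rintro x y (rfl | ⟨i, j, hij, rfl, rfl⟩)
  · exact .inl rfl
  · exact .inr ⟨i, j, h hij, rfl, rfl⟩

theorem isPlanar_addLast {n : ℕ} {P : Setoid (Fin n)} (h : IsPlanar P) :
    IsPlanar P.addLast := by
  rw [isPlanar_iff] at h ⊢
  intro a b c d hab hbc hcd hac hbd
  have hd : d ≠ Fin.last n := by
    rintro rfl
    exact absurd (eq_last_of_addLast hbd) (hbc.trans hcd).ne
  obtain ⟨d, rfl⟩ := Fin.exists_castSucc_eq.2 hd
  obtain ⟨c, rfl⟩ := Fin.exists_castSucc_eq.2 (hcd.trans (Fin.castSucc_lt_last d)).ne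
  obtain ⟨b, rfl⟩ := Fin.exists_castSucc_eq.2 (hbc.trans (Fin.castSucc_lt_last c)).ne
  obtain ⟨a, rfl⟩ := Fin.exists_castSucc_eq.2 (hab.trans (Fin.castSucc_lt_last b)).ne
  rw [addLast_castSucc] at *
  exact h a b c d hab hbc hcd hac hbd

/-- Merge the blocks of `s`, `p` and the last point. -/
def mergeLast {n : ℕ} (U : Setoid (Fin (n + 1))) (s p : Fin (n + 1)) : Setoid (Fin (n + 1)) where
  r x y := U x y ∨ ((U x s ∨ U x p ∨ U x (Fin.last n)) ∧ (U y s ∨ U y p ∨ U y (Fin.last n)))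
  iseqv :=
    { refl := fun x => .inl (U.refl' x)
      symm := by
        rintro x y (h | ⟨h, h'⟩)
        · exact .inl (U.symm' h)
        · exact .inr ⟨h', h⟩
      trans := by
        have key : ∀ {x y}, U x y → (U x s ∨ U x p ∨ U x (Fin.last n)) →
            (U y s ∨ U y p ∨ U y (Fin.last n)) := fun h =>
          Or.imp (U.trans' (U.symm' h)) (Or.imp (U.trans' (U.symm' h)) (U.trans' (U.symm' h)))
        rintro x y z (h | ⟨h, h'⟩) (k | ⟨k, k'⟩)
        · exact .inl (U.trans' h k)
        · exact .inr ⟨key (U.symm' h) k, k'⟩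
        · exact .inr ⟨h, key k h'⟩
        · exact .inr ⟨h, k'⟩ }

theorem mergeLast_apply {n : ℕ} {U : Setoid (Fin (n + 1))} {s p x y : Fin (n + 1)} :
    U.mergeLast s p x y ↔
      U x y ∨ ((U x s ∨ U x p ∨ U x (Fin.last n)) ∧ (U y s ∨ U y p ∨ U y (Fin.last n))) :=
  Iff.rfl

theorem mergeLast_last {n : ℕ} {U : Setoid (Fin (n + 1))} {s p y : Fin (n + 1)} :
    U.mergeLast s p (Fin.last n) y ↔ U y s ∨ U y p ∨ U y (Fin.last n) := by
  refine ⟨?_, fun h => .inr ⟨.inr (.inr (U.refl' _)), h⟩⟩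
  rintro (h | h)
  · exact .inr (.inr (U.symm' h))
  · exact h.2

theorem isPlanar_mergeLast {n : ℕ} {U : Setoid (Fin (n + 1))} {s p : Fin (n + 1)}
    (hlast : ∀ x, U x (Fin.last n) → x = Fin.last n) (hsp : s ≤ p) (hs : IsCut U s)
    (hp : IsCut U p) (hU : IsPlanar U) : IsPlanar (U.mergeLast s p) := by
  rw [isPlanar_iff] at hU ⊢
  have hle : ∀ {t x}, IsCut U t → U x t → t ≤ x := fun ht h =>
    not_lt.1 fun hlt => lt_irrefl _ (ht _ _ h hlt)
  -- A block cannot straddle the cut `t`, so if it surrounds a point of the block of `t`, planarity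
  -- makes it that block.
  have key : ∀ t a b c, IsCut U t → a < b → b < c → U a c → U b t → U a t := by
    intro t a b c ht hab hbc hac hbt
    have htb := hle ht hbt
    have hta : t ≤ a := not_lt.1 fun h => (ht _ _ hac h).not_ge (htb.trans hbc.le)
    rcases hta.eq_or_lt with rfl | hta
    · exact U.refl' _
    · exact U.symm' (hU t a b c hta hab hbc (U.symm' hbt) hac)
  intro a b c d hab hbc hcd hac hbd
  have hne : ∀ {x y}, x < y → ¬ U x (Fin.last n) := by
    intro x y hxy h
    obtain rfl := hlast x h
    exact hxy.not_ge (Fin.le_last y)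
  rcases hac with hac | ⟨ha, hc⟩ <;> rcases hbd with hbd | ⟨hb, hd⟩
  · exact .inl (hU a b c d hab hbc hcd hac hbd)
  · refine .inr ⟨?_, hb⟩
    rcases hb with hb | hb | hb
    · exact .inl (key s a b c hs hab hbc hac hb)
    · exact .inr (.inl (key p a b c hp hab hbc hac hb))
    · exact absurd hb (hne hbc)
  · have hcp : ∀ {t}, U a t → U c t → U.mergeLast s p a b := fun h h' =>
      .inl (hU a b c d hab hbc hcd (U.trans' h (U.symm' h')) hbd)
    rcases ha with ha' | ha' | ha' <;> rcases hc with hc | hc | hc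
    · exact hcp ha' hc
    · exact .inr ⟨.inl ha', .inr (.inl (key p b c d hp hbc hcd hbd hc))⟩
    · exact absurd hc (hne hcd)
    -- Here `c` lies beyond the cut `p` and is related to `s`, so `s` is not before `p` either.
    · obtain rfl : s = p := le_antisymm hsp
        ((hp.lt_iff hc).not.1 (((hle hp ha').trans (hab.trans hbc).le).not_gt) |> not_lt.1)
      exact hcp ha' hc
    · exact hcp ha' hc
    · exact absurd hc (hne hcd)
    all_goals exact absurd ha' (hne hab)
  · exact .inr ⟨ha, hb⟩

theorem mergeLast_mono {n : ℕ} {U V : Setoid (Fin (n + 1))} {s p : Fin (n + 1)} (h : U ≤ V) :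
    U.mergeLast p p ≤ V.mergeLast s p := by
  rintro x y (hxy | ⟨hx, hy⟩)
  · exact .inl (h hxy)
  · exact .inr ⟨by rcases hx with hx | hx | hx <;> simp [h hx],
      by rcases hy with hy | hy | hy <;> simp [h hy]⟩

theorem le_of_mergeLast_last {n : ℕ} {U : Setoid (Fin (n + 1))} {s p y : Fin (n + 1)}
    (hlast : ∀ x, U x (Fin.last n) → x = Fin.last n) (hsp : s ≤ p) (hs : IsCut U s)
    (hp : IsCut U p) (h : U.mergeLast s p (Fin.last n) y) : s ≤ y := by
  rcases mergeLast_last.1 h with h | h | h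
  · exact not_lt.1 fun hlt => lt_irrefl _ (hs _ _ h hlt)
  · exact hsp.trans (not_lt.1 fun hlt => lt_irrefl _ (hp _ _ h hlt))
  · exact hlast y h ▸ Fin.le_last s

theorem blockMin_mergeLast {n : ℕ} {U : Setoid (Fin (n + 1))} {s p : Fin (n + 1)}
    (hlast : ∀ x, U x (Fin.last n) → x = Fin.last n) (hsp : s ≤ p) (hs : IsCut U s)
    (hp : IsCut U p) : blockMin (U.mergeLast s p) (Fin.last n) = s :=
  blockMin_eq (mergeLast_last.2 (.inl (U.refl' s)))
    fun _ => le_of_mergeLast_last hlast hsp hs hp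

/-- Forget the last point and cut the partition at `s` and at `p`. -/
def cutLast {n : ℕ} (Q : Setoid (Fin (n + 1))) (s p : Fin (n + 1)) : Setoid (Fin n) where
  r x y := Q x.castSucc y.castSucc ∧ (x.castSucc < s ↔ y.castSucc < s) ∧
    (x.castSucc < p ↔ y.castSucc < p)
  iseqv :=
    { refl := fun _ => ⟨Q.refl' _, .rfl, .rfl⟩
      symm := fun h => ⟨Q.symm' h.1, h.2.1.symm, h.2.2.symm⟩
      trans := fun h h' => ⟨Q.trans' h.1 h'.1, h.2.1.trans h'.2.1, h.2.2.trans h'.2.2⟩ }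

theorem cutLast_apply {n : ℕ} {Q : Setoid (Fin (n + 1))} {s p : Fin (n + 1)} {x y : Fin n} :
    Q.cutLast s p x y ↔ Q x.castSucc y.castSucc ∧ (x.castSucc < s ↔ y.castSucc < s) ∧
      (x.castSucc < p ↔ y.castSucc < p) :=
  Iff.rfl

theorem isPlanar_cutLast {n : ℕ} {Q : Setoid (Fin (n + 1))} {s p : Fin (n + 1)}
    (h : IsPlanar Q) : IsPlanar (Q.cutLast s p) := by
  rw [isPlanar_iff] at h ⊢
  rintro a b c d hab hbc hcd ⟨hac, h1, h2⟩ ⟨hbd, -, -⟩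
  have hab' := Fin.castSucc_lt_castSucc_iff.2 hab
  have hbc' := Fin.castSucc_lt_castSucc_iff.2 hbc
  exact ⟨h _ _ _ _ hab' hbc' (Fin.castSucc_lt_castSucc_iff.2 hcd) hac hbd,
    ⟨fun k => (h1.1 k).trans' hbc', hab'.trans⟩, ⟨fun k => (h2.1 k).trans' hbc', hab'.trans⟩⟩

theorem isCut_addLast_cutLast {n : ℕ} {Q : Setoid (Fin (n + 1))} {s p : Fin (n + 1)} :
    IsCut (Q.cutLast s p).addLast s ∧ IsCut (Q.cutLast s p).addLast p := by
  constructor <;> rintro x y (rfl | ⟨i, j, h, rfl, rfl⟩)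
  exacts [id, h.2.1.1, id, h.2.2.1]

theorem cutLast_mergeLast {n : ℕ} {Q : Setoid (Fin n)} {s p : Fin (n + 1)} (hsp : s ≤ p)
    (hs : IsCut Q.addLast s) (hp : IsCut Q.addLast p) :
    (Q.addLast.mergeLast s p).cutLast s p = Q := by
  ext x y
  rw [cutLast_apply, mergeLast_apply, addLast_castSucc]
  have hle : ∀ {t x}, IsCut Q.addLast t → Q.addLast x t → t ≤ x := fun ht h =>
    not_lt.1 fun hlt => lt_irrefl _ (ht _ _ h hlt)
  have hne : ∀ x : Fin n, ¬ Q.addLast x.castSucc (Fin.last n) := fun x h =>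
    Fin.castSucc_ne_last x (eq_last_of_addLast h)
  -- The old blocks of `s` and `p` lie on opposite sides of the cut `p` unless `s = p`, so recutting
  -- undoes the merge.
  have key : ∀ x y : Fin n, Q.addLast x.castSucc s → Q.addLast y.castSucc p →
      (x.castSucc < p ↔ y.castSucc < p) → Q x y := by
    intro x y hx hy h
    have h1 : p ≤ x.castSucc := not_lt.1 (h.not.2 (hle hp hy).not_gt)
    obtain rfl : s = p := le_antisymm hsp (not_lt.1 ((hp.lt_iff hx).not.1 h1.not_gt))
    exact addLast_castSucc.1 (Q.addLast.trans' hx (Q.addLast.symm' hy))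
  constructor
  · rintro ⟨h | ⟨hx, hy⟩, h1, h2⟩
    · exact h
    · rcases hx with hx | hx | hx <;> rcases hy with hy | hy | hy
      · exact addLast_castSucc.1 (Q.addLast.trans' hx (Q.addLast.symm' hy))
      · exact key x y hx hy h2
      · exact absurd hy (hne y)
      · exact Q.symm' (key y x hy hx h2.symm)
      · exact addLast_castSucc.1 (Q.addLast.trans' hx (Q.addLast.symm' hy))
      · exact absurd hy (hne y)
      all_goals exact absurd hx (hne x)
  · intro h
    exact ⟨.inl h, hs.lt_iff (addLast_castSucc.2 h), hp.lt_iff (addLast_castSucc.2 h)⟩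

theorem addLast_cutLast_apply {n : ℕ} {Q : Setoid (Fin (n + 1))} {s p x y : Fin (n + 1)}
    (hx : x ≠ Fin.last n) (hy : y ≠ Fin.last n) :
    (Q.cutLast s p).addLast x y ↔ Q x y ∧ (x < s ↔ y < s) ∧ (x < p ↔ y < p) := by
  obtain ⟨x, rfl⟩ := Fin.exists_castSucc_eq.2 hx
  obtain ⟨y, rfl⟩ := Fin.exists_castSucc_eq.2 hy
  exact addLast_castSucc

theorem rel_of_addLast_cutLast {n : ℕ} {Q : Setoid (Fin (n + 1))} {s p x y : Fin (n + 1)}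
    (h : (Q.cutLast s p).addLast x y) : Q x y := by
  rcases h with rfl | ⟨i, j, h, rfl, rfl⟩
  · exact Q.refl' x
  · exact h.1

theorem mergeLast_cutLast {n : ℕ} {Q : Setoid (Fin (n + 1))} (hQ : IsPlanar Q) {p : Fin (n + 1)}
    (hp : Q p (Fin.last n)) :
    (Q.cutLast (blockMin Q (Fin.last n)) p).addLast.mergeLast (blockMin Q (Fin.last n)) p = Q := by
  have hcut := isCut_blockMin_last hQ
  have hs := rel_blockMin Q (Fin.last n)
  have hmin : ∀ x, Q x (Fin.last n) → blockMin Q (Fin.last n) ≤ x := fun x h =>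
    blockMin_le (Q.symm' h)
  generalize blockMin Q (Fin.last n) = s at *
  -- The block of the last point falls into its parts in `[s, p)` and from `p` on, and the last
  -- point itself; merging reunites them.
  have hM : ∀ x, ((Q.cutLast s p).addLast x s ∨ (Q.cutLast s p).addLast x p ∨
      (Q.cutLast s p).addLast x (Fin.last n)) ↔ Q x (Fin.last n) := by
    intro x
    constructor
    · rintro (h | h | h)
      · exact Q.trans' (rel_of_addLast_cutLast h) (Q.symm' hs)
      · exact Q.trans' (rel_of_addLast_cutLast h) hp
      · exact rel_of_addLast_cutLast h
    · intro h
      by_cases hx : x = Fin.last n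
      · exact .inr (.inr (.inl hx))
      have hxl := Fin.lt_last_iff_ne_last.2 hx
      have hsx := hmin x h
      rcases lt_or_ge x p with hxp | hxp
      · refine .inl ((addLast_cutLast_apply hx (hsx.trans_lt hxl).ne).2
          ⟨Q.trans' h hs, ?_, ?_⟩)
        · simp [hsx]
        · simp [hxp, hsx.trans_lt hxp]
      · refine .inr (.inl ((addLast_cutLast_apply hx (hxp.trans_lt hxl).ne).2
          ⟨Q.trans' h (Q.symm' hp), ?_, ?_⟩))
        · exact iff_of_false hsx.not_gt (hmin p hp).not_gt
        · exact iff_of_false hxp.not_gt (lt_irrefl p)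
  ext x y
  rw [mergeLast_apply, hM, hM]
  constructor
  · rintro (h | ⟨h, h'⟩)
    · exact rel_of_addLast_cutLast h
    · exact Q.trans' h (Q.symm' h')
  · intro h
    by_cases hxl : Q x (Fin.last n)
    · exact .inr ⟨hxl, Q.trans' (Q.symm' h) hxl⟩
    have hyl : ¬ Q y (Fin.last n) := fun k => hxl (Q.trans' h k)
    -- No other block is damaged at `p`: one straddling `p` would cross the block containing `p` and
    -- the last point.
    have key : ∀ x y, Q x y → ¬ Q y (Fin.last n) → x < p → y < p := by
      intro x y h hyl hxp
      by_contra! hy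
      rcases hy.eq_or_lt with rfl | hy
      · exact hyl hp
      have hyl' : y ≠ Fin.last n := by rintro rfl; exact hyl (Q.refl' _)
      exact hyl (Q.trans' (Q.symm' h) (Q.trans' (isPlanar_iff.1 hQ x p y _ hxp hy
        (Fin.lt_last_iff_ne_last.2 hyl') h hp) hp))
    exact .inl ((addLast_cutLast_apply (by rintro rfl; exact hxl (Q.refl' _))
      (by rintro rfl; exact hyl (Q.refl' _))).2 ⟨h, hcut.lt_iff h, key x y h hyl,
        key y x (Q.symm' h) hxl⟩)

end Setoid

namespace DoublePlanarPartition

theorem eq_of_fst_eq_of_snd_eq {n : ℕ} {R S : DoublePlanarPartition n} (h1 : R.fst = S.fst)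
    (h2 : R.snd = S.snd) : R = S := by
  cases R; cases S; simp_all

/-- A double planar partition of `n + 1` points amounts to a double planar partition of `n` points
with two marked cuts: cut at the least elements of the two blocks of the last point, and remove
the last point. -/
noncomputable def succEquiv (n : ℕ) : DoublePlanarPartition (n + 1) ≃
    {t : DoublePlanarPartition n × Fin (n + 1) × Fin (n + 1) // t.2.1 ≤ t.2.2 ∧
      IsCut t.1.snd.addLast t.2.1 ∧ IsCut t.1.snd.addLast t.2.2} where
  toFun R := ⟨⟨
    -- The first partition is cut at `p` only. The extra cut of the second one at `s` preserves
    -- refinement, since no block of either partition straddles `s`.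
    { fst := R.fst.cutLast (blockMin R.fst (Fin.last n)) (blockMin R.fst (Fin.last n))
      snd := R.snd.cutLast (blockMin R.snd (Fin.last n)) (blockMin R.fst (Fin.last n))
      fst_planar := Setoid.isPlanar_cutLast R.fst_planar
      snd_planar := Setoid.isPlanar_cutLast R.snd_planar
      refines := fun x y h => ⟨R.refines h.1,
        (isCut_blockMin_last R.snd_planar).lt_iff (R.refines h.1), h.2.2⟩ },
    blockMin R.snd (Fin.last n), blockMin R.fst (Fin.last n)⟩,
    blockMin_le (R.refines (rel_blockMin R.fst _)), Setoid.isCut_addLast_cutLast⟩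
  invFun t :=
    { fst := t.1.1.fst.addLast.mergeLast t.1.2.2 t.1.2.2
      snd := t.1.1.snd.addLast.mergeLast t.1.2.1 t.1.2.2
      fst_planar :=
        have h : IsCut t.1.1.fst.addLast t.1.2.2 := fun x y hxy =>
          t.2.2.2 x y (Setoid.addLast_mono t.1.1.refines hxy)
        Setoid.isPlanar_mergeLast (fun _ => Setoid.eq_last_of_addLast) le_rfl h h
          (Setoid.isPlanar_addLast t.1.1.fst_planar)
      snd_planar := Setoid.isPlanar_mergeLast (fun _ => Setoid.eq_last_of_addLast) t.2.1 t.2.2.1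
        t.2.2.2 (Setoid.isPlanar_addLast t.1.1.snd_planar)
      refines := Setoid.mergeLast_mono (Setoid.addLast_mono t.1.1.refines) }
  left_inv R := eq_of_fst_eq_of_snd_eq
    (Setoid.mergeLast_cutLast R.fst_planar (R.fst.symm' (rel_blockMin R.fst _)))
    (Setoid.mergeLast_cutLast R.snd_planar (R.refines (R.fst.symm' (rel_blockMin R.fst _))))
  right_inv := by
    rintro ⟨⟨R, s, p⟩, hsp, hs, hp⟩
    have h : IsCut R.fst.addLast p := fun x y hxy => hp x y (Setoid.addLast_mono R.refines hxy)
    dsimp only at hsp hs hp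
    have h1 : blockMin (R.snd.addLast.mergeLast s p) (Fin.last n) = s :=
      Setoid.blockMin_mergeLast (fun _ => Setoid.eq_last_of_addLast) hsp hs hp
    have h2 : blockMin (R.fst.addLast.mergeLast p p) (Fin.last n) = p :=
      Setoid.blockMin_mergeLast (fun _ => Setoid.eq_last_of_addLast) le_rfl h h
    refine Subtype.ext (Prod.ext (eq_of_fst_eq_of_snd_eq ?_ ?_) (Prod.ext h1 h2))
    · dsimp only
      rw [h2]
      exact Setoid.cutLast_mergeLast le_rfl h h
    · dsimp only
      rw [h1, h2]
      exact Setoid.cutLast_mergeLast hsp hs hp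

end DoublePlanarPartition

/-! ### The outer region and its complement. -/

/-- The closed half disc bounded by a semicircle. -/
def halfDisc (a b : ℝ) : Set ℂ :=
  {z | z ∈ halfPlane ∧ dist z (((a + b) / 2 : ℝ) : ℂ) ≤ (b - a) / 2}

theorem convex_halfPlane : Convex ℝ halfPlane := convex_halfSpace_im_ge 0

theorem convex_halfDisc (a b : ℝ) : Convex ℝ (halfDisc a b) :=
  convex_halfPlane.inter (convex_closedBall _ _)

theorem ofReal_mem_halfDisc {a b x : ℝ} : (x : ℂ) ∈ halfDisc a b ↔ a ≤ x ∧ x ≤ b := by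
  have h : dist (x : ℂ) (((a + b) / 2 : ℝ) : ℂ) = |x - (a + b) / 2| := by
    rw [Complex.dist_of_im_eq (by simp), Complex.ofReal_re, Complex.ofReal_re, Real.dist_eq]
  simp only [halfDisc, halfPlane, Set.mem_ofPred_eq, Complex.ofReal_im, le_refl, true_and, h, abs_le]
  constructor
  · rintro ⟨h1, h2⟩
    constructor <;> linarith
  · rintro ⟨h1, h2⟩
    constructor <;> linarith

theorem re_mem_Icc_of_mem_halfDisc {a b : ℝ} {z : ℂ} (h : z ∈ halfDisc a b) :
    a ≤ z.re ∧ z.re ≤ b := by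
  have h1 := (Complex.abs_re_le_norm (z - (((a + b) / 2 : ℝ) : ℂ))).trans
    ((dist_eq_norm _ _).symm.trans_le h.2)
  rw [Complex.sub_re, Complex.ofReal_re, abs_le] at h1
  constructor <;> linarith

/-- Serves as a barrier for components: a circle when `f` is the distance to a centre, a vertical
line when `f` is the real part. -/
theorem IsPreconnected.forall_lt_of_forall_ne {X : Type*} [TopologicalSpace X] {s : Set X}
    (hs : IsPreconnected s) {f : X → ℝ} (hf : Continuous f) {c : ℝ} (hc : ∀ x ∈ s, f x ≠ c)
    {x : X} (hx : x ∈ s) (hxc : f x < c) : ∀ y ∈ s, f y < c := by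
  intro y hy
  by_contra! h
  obtain ⟨z, hz, hzc⟩ := (hs.image f hf.continuousOn).ordConnected.out (Set.mem_image_of_mem f hx)
    (Set.mem_image_of_mem f hy) ⟨hxc.le, h⟩
  exact hc z hz hzc

/-- A set drawn with points of the boundary line and semicircles. -/
def drawing (S : Set ℝ) (A : Set (ℝ × ℝ)) : Set ℂ :=
  {z | ∃ x ∈ S, z = (x : ℂ)} ∪ {z | ∃ e ∈ A, z ∈ semicircle e.1 e.2}

/-- The points and closed half discs of a drawing. -/
def filling (S : Set ℝ) (A : Set (ℝ × ℝ)) : Set ℂ :=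
  {z | ∃ x ∈ S, z = (x : ℂ)} ∪ {z | ∃ e ∈ A, z ∈ halfDisc e.1 e.2}

theorem drawing_subset_filling (S : Set ℝ) (A : Set (ℝ × ℝ)) : drawing S A ⊆ filling S A := by
  rintro z (h | ⟨e, he, h⟩)
  · exact .inl h
  · exact .inr ⟨e, he, h.1, h.2.le⟩

theorem isBounded_connectedComponentIn_of_mem_halfDisc {D : Set ℂ} {a b : ℝ}
    (hD : semicircle a b ⊆ D) {z : ℂ} (hz : z ∈ halfDisc a b) (hzD : z ∉ D) :
    Bornology.IsBounded (connectedComponentIn (halfPlane \ D) z) := by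
  refine (Metric.isBounded_ball (x := (((a + b) / 2 : ℝ) : ℂ)) (r := (b - a) / 2)).subset ?_
  intro w hw
  have hsub := connectedComponentIn_subset (halfPlane \ D) z
  refine isPreconnected_connectedComponentIn.forall_lt_of_forall_ne
    (f := fun w => dist w (((a + b) / 2 : ℝ) : ℂ)) (by fun_prop)
    (fun x hx h => (hsub hx).2 (hD ⟨(hsub hx).1, h⟩))
    (mem_connectedComponentIn ⟨hz.1, hzD⟩) (hz.2.lt_of_ne fun h => hzD (hD ⟨hz.1, h⟩)) w hw

/-- Moving upwards never decreases the distance to a centre on the boundary line, so a vertical ray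
leads from `z` to infinity. -/
theorem not_mem_filling_add {S : Set ℝ} {A : Set (ℝ × ℝ)} {z : ℂ} (hz : z ∈ halfPlane)
    (hzF : z ∉ filling S A) {t : ℝ} (ht : 0 ≤ t) : z + t * Complex.I ∉ filling S A := by
  have hz0 : 0 ≤ z.im := hz
  rintro (⟨x, hx, h⟩ | ⟨e, he, -, h⟩)
  · have h1 := congrArg Complex.im h
    simp only [Complex.add_im, Complex.mul_im, Complex.ofReal_re, Complex.I_im, Complex.ofReal_im,
      Complex.I_re] at h1
    obtain rfl : t = 0 := by linarith
    exact hzF (.inl ⟨x, hx, by simpa using h⟩)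
  · refine hzF (.inr ⟨e, he, hz, le_trans ?_ h⟩)
    rw [Complex.dist_eq_re_im, Complex.dist_eq_re_im]
    apply Real.sqrt_le_sqrt
    simp only [Complex.add_re, Complex.add_im, Complex.mul_re, Complex.mul_im, Complex.ofReal_re,
      Complex.I_im, Complex.ofReal_im, Complex.I_re]
    nlinarith [mul_nonneg hz0 ht]

theorem not_isBounded_connectedComponentIn_of_notMem_filling {S : Set ℝ} {A : Set (ℝ × ℝ)} {z : ℂ}
    (hz : z ∈ halfPlane) (hzF : z ∉ filling S A) :
    ¬ Bornology.IsBounded (connectedComponentIn (halfPlane \ drawing S A) z) := by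
  intro hb
  have hray : (fun t : ℝ => z + t * Complex.I) '' Set.Ici 0 ⊆
      connectedComponentIn (halfPlane \ drawing S A) z := by
    refine IsPreconnected.subset_connectedComponentIn ?_ ⟨0, by simp, by simp⟩ ?_
    · exact isPreconnected_Ici.image _ (by fun_prop)
    · rintro _ ⟨t, ht, rfl⟩
      refine ⟨?_, fun h => not_mem_filling_add hz hzF ht (drawing_subset_filling S A h)⟩
      have : 0 ≤ z.im := hz
      simpa [halfPlane] using add_nonneg this ht
  obtain ⟨C, hC⟩ := (hb.subset hray).exists_norm_le
  have h1 := hC _ ⟨|C| + 1, by simp; positivity, rfl⟩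
  have h2 := (Complex.abs_im_le_norm _).trans h1
  have h3 : 0 ≤ z.im := hz
  simp only [Complex.add_im, Complex.mul_im, Complex.ofReal_re, Complex.I_im, Complex.ofReal_im,
    Complex.I_re] at h2
  linarith [le_abs_self (z.im + ((|C| + 1) * 1 + 0 * 0)), le_abs_self C]

theorem filling_subset_halfPlane (S : Set ℝ) (A : Set (ℝ × ℝ)) : filling S A ⊆ halfPlane := by
  rintro z (⟨x, -, rfl⟩ | ⟨e, -, h⟩)
  · simp [halfPlane]
  · exact h.1

theorem halfPlane_diff_outerRegion_drawing (S : Set ℝ) (A : Set (ℝ × ℝ)) :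
    halfPlane \ outerRegion (drawing S A) = filling S A := by
  ext z
  constructor
  · rintro ⟨hz, h⟩
    by_contra hF
    exact h ⟨⟨hz, fun hD => hF (drawing_subset_filling S A hD)⟩,
      not_isBounded_connectedComponentIn_of_notMem_filling hz hF⟩
  · intro hF
    refine ⟨filling_subset_halfPlane S A hF, fun h => ?_⟩
    rcases hF with hF | ⟨e, he, hF⟩
    · exact h.1.2 (.inl hF)
    · exact h.2 (isBounded_connectedComponentIn_of_mem_halfDisc
        (fun w hw => .inr ⟨e, he, hw⟩) hF h.1.2)

/-! ### Boxes correspond to cuts. -/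

open Classical in
/-- The points `k` such that no block of `Q` bridges the gap before `k`: the least elements of the
connected parts of the diagram of `Q`. -/
noncomputable def starts {n : ℕ} (Q : Setoid (Fin n)) : Finset (Fin n) :=
  Finset.univ.filter (IsCut Q)

theorem mem_starts {n : ℕ} {Q : Setoid (Fin n)} {k : Fin n} : k ∈ starts Q ↔ IsCut Q k := by
  simp [starts]

namespace DoublePlanarPartition

variable {n : ℕ} (R : DoublePlanarPartition n)

/-- The end points of the arcs and ties. -/
def edges : Set (ℝ × ℝ) :=
  {e | ∃ i j : Fin n, (IsArc R.fst i j ∨ IsTie R.fst R.snd i j) ∧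
    e = (((i : ℕ) : ℝ), ((j : ℕ) : ℝ))}

theorem diagram_eq_drawing :
    R.diagram = drawing (Set.range fun i : Fin n => ((i : ℕ) : ℝ)) R.edges := by
  ext z
  simp only [diagram, drawing, edges, Set.mem_union, Set.mem_ofPred_eq, Set.exists_range_iff,
    Complex.ofReal_natCast]
  refine or_congr Iff.rfl ⟨?_, ?_⟩
  · rintro ⟨i, j, h, hz⟩
    exact ⟨_, ⟨i, j, h, rfl⟩, hz⟩
  · rintro ⟨_, ⟨i, j, h, rfl⟩, hz⟩
    exact ⟨i, j, h, hz⟩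

/-- The union of the boxes. -/
def region : Set ℂ := filling (Set.range fun i : Fin n => ((i : ℕ) : ℝ)) R.edges

theorem natCast_mem_region (i : Fin n) : ((i : ℕ) : ℂ) ∈ R.region :=
  .inl ⟨_, ⟨i, rfl⟩, by simp⟩

theorem boxes_diagram :
    boxes R.diagram = (fun z => connectedComponentIn R.region z) '' R.region := by
  rw [boxes, diagram_eq_drawing, halfPlane_diff_outerRegion_drawing]
  rfl

theorem connectedComponentIn_region_eq {a b : Fin n} (hab : (((a : ℕ) : ℝ), ((b : ℕ) : ℝ)) ∈ R.edges)
    {z w : ℂ} (hz : z ∈ halfDisc (a : ℕ) (b : ℕ)) (hw : w ∈ halfDisc (a : ℕ) (b : ℕ)) :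
    connectedComponentIn R.region z = connectedComponentIn R.region w := by
  refine connectedComponentIn_eq ?_
  exact (convex_halfDisc _ _).isPreconnected.subset_connectedComponentIn hz
    (fun x hx => .inr ⟨_, hab, hx⟩) hw

theorem natCast_mem_halfDisc {a b i : Fin n} :
    ((i : ℕ) : ℂ) ∈ halfDisc (a : ℕ) (b : ℕ) ↔ a ≤ i ∧ i ≤ b := by
  rw [← Complex.ofReal_natCast, ofReal_mem_halfDisc]
  simp

theorem exists_edge_iff_not_isCut (k : Fin n) :
    (∃ i j : Fin n, (IsArc R.fst i j ∨ IsTie R.fst R.snd i j) ∧ i < k ∧ k ≤ j) ↔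
      ¬ IsCut R.snd k := by
  rw [exists_isArc_or_isTie_iff R.refines]
  simp [IsCut]

/-- If the gap before `k` is bridged, the half disc of the bridging edge connects `k` to its left
end, an earlier point; descend. -/
theorem exists_mem_starts (k : Fin n) : ∃ i ∈ starts R.snd,
    connectedComponentIn R.region ((k : ℕ) : ℂ) = connectedComponentIn R.region ((i : ℕ) : ℂ) := by
  induction k using WellFoundedLT.induction with
  | ind k ih =>
    by_cases hk : IsCut R.snd k
    · exact ⟨k, mem_starts.2 hk, rfl⟩
    · obtain ⟨a, b, hab, hak, hkb⟩ := (R.exists_edge_iff_not_isCut k).2 hk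
      obtain ⟨i, hi, h⟩ := ih a hak
      refine ⟨i, hi, h ▸ R.connectedComponentIn_region_eq ⟨a, b, hab, rfl⟩ ?_ ?_⟩
      · exact natCast_mem_halfDisc.2 ⟨hak.le, hkb⟩
      · exact natCast_mem_halfDisc.2 ⟨le_rfl, hak.le.trans hkb⟩

/-- The vertical line midway between `k - 1` and `k` meets no marked point and no half disc, as all
end points are integers and no edge bridges the gap. -/
theorem re_ne_of_mem_region {k : Fin n} (hk : IsCut R.snd k) {z : ℂ} (hz : z ∈ R.region) :
    z.re ≠ (k : ℕ) - 1 / 2 := by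
  intro h
  rcases hz with ⟨_, ⟨i, rfl⟩, rfl⟩ | ⟨_, ⟨i, j, hij, rfl⟩, hz⟩
  · simp only [Complex.ofReal_re] at h
    have h' : ((2 * (i : ℕ) + 1 : ℕ) : ℝ) = (2 * (k : ℕ) : ℕ) := by push_cast; linarith
    have := Nat.cast_injective h'
    omega
  · obtain ⟨h1, h2⟩ := re_mem_Icc_of_mem_halfDisc hz
    refine (R.exists_edge_iff_not_isCut k).1 ⟨i, j, hij, ?_, ?_⟩ hk
    · rw [Fin.lt_def, ← Nat.cast_lt (α := ℝ)]
      linarith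
    · rw [Fin.le_def, ← Nat.lt_succ_iff, ← Nat.cast_lt (α := ℝ)]
      push_cast
      linarith

theorem injOn_starts : Set.InjOn
    (fun i : Fin n => connectedComponentIn R.region ((i : ℕ) : ℂ)) (starts R.snd) := by
  have key : ∀ i k : Fin n, i < k → IsCut R.snd k →
      connectedComponentIn R.region ((i : ℕ) : ℂ) ≠ connectedComponentIn R.region ((k : ℕ) : ℂ) := by
    intro i k hik hk h
    have hlt := (isPreconnected_connectedComponentIn (F := R.region)
      (x := ((i : ℕ) : ℂ))).forall_lt_of_forall_ne Complex.continuous_re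
      (fun x hx => R.re_ne_of_mem_region hk (connectedComponentIn_subset _ _ hx))
      (mem_connectedComponentIn (R.natCast_mem_region i)) (by
        rw [Complex.natCast_re]
        have : ((i : ℕ) : ℝ) + 1 ≤ (k : ℕ) := by exact_mod_cast hik
        linarith) _ (h ▸ mem_connectedComponentIn (R.natCast_mem_region k))
    rw [Complex.natCast_re] at hlt
    linarith
  intro i hi k hk h
  rcases lt_trichotomy i k with hik | hik | hik
  · exact absurd h (key i k hik (mem_starts.1 hk))
  · exact hik
  · exact absurd h.symm (key k i hik (mem_starts.1 hi))

theorem ncard_boxes : (boxes R.diagram).ncard = (starts R.snd).card := by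
  have : boxes R.diagram =
      (fun i : Fin n => connectedComponentIn R.region ((i : ℕ) : ℂ)) '' (starts R.snd) := by
    rw [boxes_diagram]
    apply Set.Subset.antisymm
    · rintro _ ⟨z, hz, rfl⟩
      rcases hz with ⟨_, ⟨i, rfl⟩, rfl⟩ | ⟨_, ⟨a, b, hab, rfl⟩, hz⟩
      · obtain ⟨j, hj, h⟩ := R.exists_mem_starts i
        exact ⟨j, hj, by simpa using h.symm⟩
      · obtain ⟨j, hj, h⟩ := R.exists_mem_starts a
        refine ⟨j, hj, h.symm.trans (R.connectedComponentIn_region_eq ⟨a, b, hab, rfl⟩ ?_ hz)⟩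
        -- The half disc contains `z`, so its end points are in order and `a` belongs to it.
        have hle := (re_mem_Icc_of_mem_halfDisc hz)
        have : a ≤ b := by
          rw [Fin.le_def, ← Nat.cast_le (α := ℝ)]
          exact hle.1.trans hle.2
        exact natCast_mem_halfDisc.2 ⟨le_rfl, this⟩
    · rintro _ ⟨i, -, rfl⟩
      exact ⟨_, R.natCast_mem_region i, rfl⟩
  rw [this, R.injOn_starts.ncard_image, Set.ncard_coe_finset]

end DoublePlanarPartition

/-! ### Counting pairs of marked cuts. -/

/-- The rank forces the first entry to be the `m`-th element, and the second is any element from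
there on. Truncated subtraction covers `m > K.card`. -/
theorem Finset.card_filter_le_and_rank_eq {α : Type*} [LinearOrder α] (K : Finset α) {m : ℕ}
    (hm : 0 < m) :
    ((K ×ˢ K).filter fun t => t.1 ≤ t.2 ∧ (K.filter (· ≤ t.1)).card = m).card =
      K.card + 1 - m := by
  classical
  set e := K.orderEmbOfFin rfl with he
  have hmem : ∀ x, x ∈ K ↔ ∃ i, e i = x := fun x => by
    rw [← Set.mem_range, he, Finset.range_orderEmbOfFin, Finset.mem_coe]
  have hrank : ∀ i, (K.filter (· ≤ e i)).card = i + 1 := by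
    intro i
    have : K.filter (· ≤ e i) = (Finset.Iic i).map e.toEmbedding := by
      ext x
      simp only [Finset.mem_filter, hmem, Finset.mem_map, Finset.mem_Iic]
      constructor
      · rintro ⟨⟨j, rfl⟩, h⟩
        exact ⟨j, e.le_iff_le.1 h, rfl⟩
      · rintro ⟨j, h, rfl⟩
        exact ⟨⟨j, rfl⟩, e.le_iff_le.2 h⟩
    rw [this, Finset.card_map, Fin.card_Iic]
  rcases Nat.lt_or_ge K.card m with h | h
  · rw [Nat.sub_eq_zero_of_le h, Finset.card_eq_zero, Finset.filter_eq_empty_iff]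
    rintro ⟨x, y⟩ - ⟨-, h'⟩
    exact (Finset.card_filter_le K _).not_gt (h'.symm ▸ h)
  · have hi : m - 1 < K.card := by omega
    have : ((K ×ˢ K).filter fun t => t.1 ≤ t.2 ∧ (K.filter (· ≤ t.1)).card = m) =
        {e ⟨m - 1, hi⟩} ×ˢ (Finset.Ici ⟨m - 1, hi⟩).map e.toEmbedding := by
      ext ⟨x, y⟩
      simp only [Finset.mem_filter, Finset.mem_product, Finset.mem_map, Finset.mem_Ici,
        Finset.mem_singleton, hmem]
      constructor
      · rintro ⟨⟨⟨i, rfl⟩, ⟨j, rfl⟩⟩, hij, h⟩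
        rw [hrank] at h
        obtain rfl : i = ⟨m - 1, hi⟩ := Fin.ext (by dsimp only; omega)
        exact ⟨rfl, j, e.le_iff_le.1 hij, rfl⟩
      · rintro ⟨rfl, j, hj, rfl⟩
        refine ⟨⟨⟨_, rfl⟩, ⟨j, rfl⟩⟩, e.le_iff_le.2 hj, ?_⟩
        rw [hrank]
        dsimp only
        omega
    rw [this, Finset.card_product, Finset.card_singleton, Finset.card_map, Fin.card_Ici]
    dsimp only
    omega

theorem starts_addLast {n : ℕ} (Q : Setoid (Fin n)) :
    (starts Q.addLast).card = (starts Q).card + 1 := by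
  classical
  have : starts Q.addLast = insert (Fin.last n) ((starts Q).map Fin.castSuccEmb) := by
    ext k
    rw [mem_starts, Finset.mem_insert, Finset.mem_map]
    constructor
    · intro hk
      by_cases hl : k = Fin.last n
      · exact .inl hl
      · obtain ⟨i, rfl⟩ := Fin.exists_castSucc_eq.2 hl
        refine .inr ⟨i, mem_starts.2 fun x y hxy hx => ?_, rfl⟩
        exact Fin.castSucc_lt_castSucc_iff.1
          (hk _ _ (Setoid.addLast_castSucc.2 hxy) (Fin.castSucc_lt_castSucc_iff.2 hx))
    · rintro (rfl | ⟨i, hi, rfl⟩) x y (rfl | ⟨a, b, hab, rfl, rfl⟩) hx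
      · exact hx
      · exact Fin.castSucc_lt_last b
      · exact hx
      · exact Fin.castSucc_lt_castSucc_iff.2
          (mem_starts.1 hi a b hab (Fin.castSucc_lt_castSucc_iff.1 hx))
  rw [this, Finset.card_insert_of_notMem, Finset.card_map]
  rw [Finset.mem_map]
  rintro ⟨i, -, h⟩
  exact Fin.castSucc_ne_last i h

/-- The merged block reaches from `s` to the last point: it bridges every gap after `s` and none up
to `s`. -/
theorem starts_mergeLast {n : ℕ} {U : Setoid (Fin (n + 1))} {s p : Fin (n + 1)}
    (hlast : ∀ x, U x (Fin.last n) → x = Fin.last n) (hsp : s ≤ p) (hs : IsCut U s)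
    (hp : IsCut U p) : starts (U.mergeLast s p) = (starts U).filter (· ≤ s) := by
  ext k
  rw [Finset.mem_filter, mem_starts, mem_starts]
  constructor
  · refine fun hk => ⟨fun x y h => hk x y (.inl h), ?_⟩
    by_contra! hsk
    exact (hk s (Fin.last n) (Setoid.symm' _ (Setoid.mergeLast_last.2 (.inl (U.refl' s))))
      hsk).not_ge (Fin.le_last k)
  · rintro ⟨hk, hks⟩ x y (h | ⟨h, -⟩) hx
    · exact hk x y h hx
    · exact absurd (hks.trans (Setoid.le_of_mergeLast_last hlast hsp hs hp
        (Setoid.mergeLast_last.2 h))) hx.not_ge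

/-! ### The recurrence and the total number. -/

namespace DoublePlanarPartition

instance (n : ℕ) : Finite (DoublePlanarPartition n) := by
  refine Finite.of_injective
    (fun R : DoublePlanarPartition n => (fun x y => R.fst x y, fun x y => R.snd x y)) ?_
  intro R S h
  rw [Prod.ext_iff] at h
  exact eq_of_fst_eq_of_snd_eq (Setoid.ext fun x y => (congrFun (congrFun h.1 x) y).to_iff)
    (Setoid.ext fun x y => (congrFun (congrFun h.2 x) y).to_iff)

noncomputable instance (n : ℕ) : Fintype (DoublePlanarPartition n) := Fintype.ofFinite _

theorem card_starts_le {n : ℕ} (R : DoublePlanarPartition n) : (starts R.snd).card ≤ n :=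
  (Finset.card_le_univ _).trans_eq (Fintype.card_fin n)

theorem card_succ_starts_eq_sum (n : ℕ) {m : ℕ} (hm : 0 < m) :
    Nat.card {R : DoublePlanarPartition (n + 1) // (starts R.snd).card = m} =
      ∑ R : DoublePlanarPartition n, ((starts R.snd).card + 2 - m) := by
  classical
  let e : {R : DoublePlanarPartition (n + 1) // (starts R.snd).card = m} ≃
      Σ R : DoublePlanarPartition n, {t : Fin (n + 1) × Fin (n + 1) // t ∈
        (starts R.snd.addLast ×ˢ starts R.snd.addLast).filter fun t =>
          t.1 ≤ t.2 ∧ ((starts R.snd.addLast).filter (· ≤ t.1)).card = m} :=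
    ((succEquiv n).subtypeEquiv (q := fun t =>
      ((starts t.1.1.snd.addLast).filter (· ≤ t.1.2.1)).card = m) fun R => by
        obtain ⟨t, rfl⟩ := (succEquiv n).symm.surjective R
        rw [Equiv.apply_symm_apply, ← starts_mergeLast (fun _ => Setoid.eq_last_of_addLast)
          t.2.1 t.2.2.1 t.2.2.2]
        rfl).trans
    { toFun t := ⟨t.1.1.1, t.1.1.2, Finset.mem_filter.2 ⟨Finset.mem_product.2
        ⟨mem_starts.2 t.1.2.2.1, mem_starts.2 t.1.2.2.2⟩, t.1.2.1, t.2⟩⟩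
      invFun t :=
        have h := Finset.mem_filter.1 t.2.2
        have h' := Finset.mem_product.1 h.1
        ⟨⟨⟨t.1, t.2.1⟩, h.2.1, mem_starts.1 h'.1, mem_starts.1 h'.2⟩, h.2.2⟩
      left_inv _ := rfl
      right_inv _ := rfl }
  rw [Nat.card_congr e, Nat.card_sigma]
  refine Finset.sum_congr rfl fun R _ => ?_
  rw [Nat.card_eq_fintype_card, Fintype.card_coe, Finset.card_filter_le_and_rank_eq _ hm,
    starts_addLast]

theorem card_starts_eq_fussCatalanTriangle (n : ℕ) : ∀ k ≤ n,
    Nat.card {R : DoublePlanarPartition n // (starts R.snd).card = n - k} =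
      fussCatalanTriangle 3 n k := by
  classical
  induction n with
  | zero =>
    intro k hk
    obtain rfl : k = 0 := by omega
    let R : DoublePlanarPartition 0 := ⟨⊥, ⊥, fun a => a.elim0, fun a => a.elim0, le_rfl⟩
    rw [fussCatalanTriangle, if_pos rfl, Nat.card_eq_one_iff_exists]
    refine ⟨⟨R, by simpa using R.card_starts_le⟩, fun S => Subtype.ext (eq_of_fst_eq_of_snd_eq ?_ ?_)⟩ <;>
      exact Setoid.ext fun a => a.elim0
  | succ n ih =>
    intro k hk
    rcases hk.eq_or_lt with rfl | hk
    -- A nonempty diagram has a box, since the point `0` is always a cut.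
    · rw [fussCatalanTriangle, if_neg (lt_irrefl _), Nat.sub_self]
      refine @Nat.card_of_isEmpty _ ⟨fun R => ?_⟩
      have h0 : (0 : Fin (n + 1)) ∈ starts R.1.snd :=
        mem_starts.2 fun x y _ h => absurd h (Fin.not_lt_zero x)
      have h1 := R.2
      rw [Finset.card_eq_zero] at h1
      simp [h1] at h0
    · rw [fussCatalanTriangle_three_succ (by omega), card_succ_starts_eq_sum n (by omega)]
      have hmaps : ∀ R ∈ (Finset.univ : Finset (DoublePlanarPartition n)),
          n - (starts R.snd).card ∈ Finset.range (n + 1) := fun R _ =>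
        Finset.mem_range.2 (by omega)
      rw [← Finset.sum_fiberwise_of_maps_to hmaps]
      -- Group by `j = n - (starts R.snd).card`. The weight `k + 1 - j` truncates to `0` for `j >
      -- k`, which later shortens the sum to `j ≤ k`.
      have hfib : ∀ j ∈ Finset.range (n + 1),
          (∑ R ∈ Finset.univ.filter fun R : DoublePlanarPartition n =>
            n - (starts R.snd).card = j, ((starts R.snd).card + 2 - (n + 1 - k))) =
          (k + 1 - j) * fussCatalanTriangle 3 n j := by
        intro j hj
        have hj := Finset.mem_range.1 hj
        rw [← ih j (by omega), Nat.card_eq_fintype_card, Fintype.card_subtype, mul_comm]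
        have : (Finset.univ.filter fun R : DoublePlanarPartition n =>
            (starts R.snd).card = n - j) =
            Finset.univ.filter fun R => n - (starts R.snd).card = j :=
          Finset.filter_congr fun R _ => by have := R.card_starts_le; omega
        rw [this]
        refine Finset.sum_const_nat fun R hR => ?_
        have := (Finset.mem_filter.1 hR).2
        have := R.card_starts_le
        omega
      rw [Finset.sum_congr rfl hfib]
      symm
      refine Finset.sum_subset_zero_on_sdiff (by simpa using hk) ?_ ?_
      · intro j hj
        have := (Finset.mem_sdiff.1 hj).2
        rw [Finset.mem_range] at this
        rw [show k + 1 - j = 0 by omega, zero_mul]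
      · intro j hj
        have := Finset.mem_range.1 hj
        rw [show k + 1 - j = k - j + 1 by omega]

theorem card_eq_fussCatalan (n : ℕ) :
    (Nat.card (DoublePlanarPartition n) : ℚ) = fussCatalan 3 n := by
  classical
  rw [← sum_fussCatalanTriangle_three, Nat.card_eq_fintype_card, ← Finset.card_univ,
    Finset.card_eq_sum_card_fiberwise (t := Finset.range (n + 1))
      (f := fun R : DoublePlanarPartition n => n - (starts R.snd).card)
      (fun R _ => Finset.mem_coe.2 (Finset.mem_range.2 (Nat.lt_succ_of_le (Nat.sub_le _ _))))]
  push_cast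
  refine Finset.sum_congr rfl fun k hk => ?_
  have hk := Finset.mem_range.1 hk
  rw [← card_starts_eq_fussCatalanTriangle n k (by omega), Nat.card_eq_fintype_card,
    Fintype.card_subtype]
  congr 2
  exact Finset.filter_congr fun R _ => by have := R.card_starts_le; omega

end DoublePlanarPartition

theorem mainTheorem3 (n : ℕ) :
    (∀ k : ℕ, k ≤ n →
      Nat.card {R : DoublePlanarPartition n // (boxes R.diagram).ncard = n - k} =
        fussCatalanTriangle 3 n k) ∧
    (Nat.card (DoublePlanarPartition n) : ℚ) = fussCatalan 3 n := by
  refine ⟨fun k hk => ?_, DoublePlanarPartition.card_eq_fussCatalan n⟩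
  simp only [DoublePlanarPartition.ncard_boxes]
  exact DoublePlanarPartition.card_starts_eq_fussCatalanTriangle n k hk
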